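/- For integers $N\ge 0$ and $k$, let $\Delta_N$ be the $N$-dimensional simplex and $\Delta_N^{\le k}$ its $k$-skeleton, the union of its faces of dimension at most $k$. For $d\ge 1$, a $d$-simplex $\sigma$, a continuous map $g:\partial\sigma\to\mathbb{R}^d$ and a point $p\in\mathbb{R}^d\setminus g(\partial\sigma)$, the winding number $W(g,p)$ is the class $[g]$ in the reduced singular homology group $\widetilde H_{d-1}(\mathbb{R}^d\setminus\{p\};\mathbb{Z})\cong\mathbb{Z}$ of the image under $g$ of the fundamental cycle of $\partial\sigma\cong S^{d-1}$; it is defined up to sign, so the condition $W(g,p)\ne 0$ is well defined. For integers $d\ge 1$ and $q\ge 2$, the Winding Number Conjecture for $(q,d)$ is the assertion that for every continuous map $f:\Delta_{(d+1)(q-1)}^{\le d-1}\to\mathbb{R}^d$ there are $q$ pairwise disjoint nonempty faces $\sigma_1,\dots,\sigma_q$ of $\Delta_{(d+1)(q-1)}$, each of dimension at most $d$, and a point $p\in\mathbb{R}^d$ such that for each $i$ one of the following holds: - $\dim\sigma_i\le d-1$ and $p\in f(\sigma_i)$; - $\dim\sigma_i=d$, and either $p\in f(\partial\sigma_i)$,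 or $p\notin f(\partial\sigma_i)$ and $W(f|_{\partial\sigma_i},p)\ne 0$. **Proposition.** Let $q\ge 2$ and $d\ge 1$ be integers. If the Winding Number Conjecture holds for $(q,d+1)$, then it holds for $(q,d)$. -/

import Mathlib

namespace Winding

noncomputable section

/-! ### Faces and skeleta of the standard simplex -/

/-- The (closed) face of the simplex with vertex set `V` that is spanned by the vertices in `τ`. -/
def face {V : Type} [Fintype V] (τ : Finset V) : Set (stdSimplex ℝ V) :=
  {x | ∀ v, v ∉ τ → x v = 0}

/-- The union of all faces with at most `m` vertices of the simplex with vertex set `V`, that is,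
its `(m - 1)`-skeleton. In particular `skeleton (Fin (d + 1)) d` is the boundary `∂Δ_d` of the
`d`-simplex. -/
def skeleton (V : Type) [Fintype V] (m : ℕ) : Set (stdSimplex ℝ V) :=
  {x | ∃ τ : Finset V, τ.card ≤ m ∧ x ∈ face τ}

/-- The affine map between standard simplices induced by a map of vertices. -/
def simplexMap {V W : Type} [Fintype V] [Fintype W] (j : V → W) :
    C(stdSimplex ℝ V, stdSimplex ℝ W) :=
  ⟨stdSimplex.map j, stdSimplex.continuous_map j⟩

theorem simplexMap_mem_face {V W : Type} [Fintype V] [Fintype W] [DecidableEq W] (j : V → W)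
    {τ : Finset V} {x : stdSimplex ℝ V} (hx : x ∈ face τ) :
    simplexMap j x ∈ face (τ.image j) := by
  classical
  intro w hw
  change FunOnFinite.linearMap ℝ ℝ j x w = 0
  rw [FunOnFinite.linearMap_apply_apply]
  refine Finset.sum_eq_zero fun v hv => hx v fun hvτ => hw ?_
  rw [Finset.mem_filter] at hv
  rw [← hv.2]
  exact Finset.mem_image_of_mem j hvτ

theorem simplexMap_mem_skeleton {V W : Type} [Fintype V] [Fintype W] (j : V → W) {m : ℕ}
    {x : stdSimplex ℝ V} (hx : x ∈ skeleton V m) : simplexMap j x ∈ skeleton W m := by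
  classical
  obtain ⟨τ, hτ, hxτ⟩ := hx
  exact ⟨τ.image j, Finset.card_image_le.trans hτ, simplexMap_mem_face j hxτ⟩

theorem mem_skeleton_of_card_le {V : Type} [Fintype V] {m : ℕ} (h : Fintype.card V ≤ m)
    (x : stdSimplex ℝ V) : x ∈ skeleton V m :=
  ⟨Finset.univ, h, fun v hv => absurd (Finset.mem_univ v) hv⟩

/-- The map between skeleta induced by a map of vertices. -/
def skeletonMap {V W : Type} [Fintype V] [Fintype W] (j : V → W) (m : ℕ) :
    C(skeleton V m, skeleton W m) where
  toFun x := ⟨simplexMap j x, simplexMap_mem_skeleton j x.2⟩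
  continuous_toFun := ((simplexMap j).continuous.comp continuous_subtype_val).subtype_mk _

/-! ### Reduced singular homology

Singular simplices are indexed by their number `n` of vertices, so `Chains X n` is the group of
singular `(n - 1)`-chains. For `n = 0` the simplex is empty and has exactly one map to `X`, hence
`Chains X 0` is `ℤ`, the differential `Chains X 1 → Chains X 0` is the augmentation, and the whole
is the augmented singular chain complex of `X`. -/

/-- Singular `(n - 1)`-chains of `X` with integer coefficients (the augmentation term `ℤ` for
`n = 0`). -/
abbrev Chains (X : Type) [TopologicalSpace X] (n : ℕ) : Type :=
  C(stdSimplex ℝ (Fin n), X) →₀ ℤ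

/-- The inclusion of the facet opposite to vertex `i`. -/
abbrev facet {n : ℕ} (i : Fin (n + 1)) : C(stdSimplex ℝ (Fin n), stdSimplex ℝ (Fin (n + 1))) :=
  simplexMap i.succAbove

/-- The alternating sum of the facets of a singular simplex, extended linearly. -/
def boundarySucc (X : Type) [TopologicalSpace X] (n : ℕ) : Chains X (n + 1) →+ Chains X n :=
  Finsupp.liftAddHom fun s =>
    (zmultiplesHom (Chains X n))
      (∑ i : Fin (n + 1), (-1 : ℤ) ^ (i : ℕ) • Finsupp.single (s.comp (facet i)) (1 : ℤ))

/-- The differential of the augmented singular chain complex (zero on the last term). -/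
def boundary (X : Type) [TopologicalSpace X] : (n : ℕ) → Chains X n →+ Chains X (n - 1)
  | 0 => 0
  | n + 1 => boundarySucc X n

/-- The map on singular chains induced by a continuous map. -/
def chainsMap {X Y : Type} [TopologicalSpace X] [TopologicalSpace Y] (g : C(X, Y)) (n : ℕ) :
    Chains X n →+ Chains Y n :=
  Finsupp.mapDomain.addMonoidHom fun s => g.comp s

/-- The cycles of the augmented singular chain complex in degree `n - 1`. -/
def cycles (X : Type) [TopologicalSpace X] (n : ℕ) : AddSubgroup (Chains X n) :=
  (boundary X n).ker

/-- The boundaries of the augmented singular chain complex in degree `n - 1`. -/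
def boundaries (X : Type) [TopologicalSpace X] (n : ℕ) : AddSubgroup (Chains X n) :=
  (boundary X (n + 1)).range

/-- The reduced singular homology group `H̃_{n-1}(X; ℤ)`. -/
abbrev ReducedHomology (X : Type) [TopologicalSpace X] (n : ℕ) : Type :=
  cycles X n ⧸ (boundaries X n).addSubgroupOf (cycles X n)

theorem boundarySucc_single {X : Type} [TopologicalSpace X] {n : ℕ}
    (s : C(stdSimplex ℝ (Fin (n + 1)), X)) :
    boundarySucc X n (Finsupp.single s 1) =
      ∑ i : Fin (n + 1), (-1 : ℤ) ^ (i : ℕ) • Finsupp.single (s.comp (facet i)) (1 : ℤ) := by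
  simp [boundarySucc]

theorem chainsMap_single {X Y : Type} [TopologicalSpace X] [TopologicalSpace Y] (g : C(X, Y))
    {n : ℕ} (s : C(stdSimplex ℝ (Fin n), X)) (a : ℤ) :
    chainsMap g n (Finsupp.single s a) = Finsupp.single (g.comp s) a := by
  simp [chainsMap]

theorem facet_comp_facet {n : ℕ} (i : Fin (n + 2)) (j : Fin (n + 1)) :
    (facet (i.succAbove j)).comp (facet (j.predAbove i)) = (facet i).comp (facet j) := by
  ext1 x
  change stdSimplex.map _ (stdSimplex.map _ x) = stdSimplex.map _ (stdSimplex.map _ x)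
  rw [stdSimplex.map_comp_apply, stdSimplex.map_comp_apply]
  congr 1
  funext k
  exact Fin.succAbove_succAbove_succAbove_predAbove i j k

theorem boundarySucc_boundarySucc {X : Type} [TopologicalSpace X] {n : ℕ}
    (c : Chains X (n + 2)) : boundarySucc X n (boundarySucc X (n + 1) c) = 0 := by
  suffices h : (boundarySucc X n).comp (boundarySucc X (n + 1)) = 0 from
    DFunLike.congr_fun h c
  refine Finsupp.addHom_ext' fun s => AddMonoidHom.ext_int ?_
  change boundarySucc X n (boundarySucc X (n + 1) (Finsupp.single s 1)) = 0
  simp only [boundarySucc_single, map_sum, map_zsmul, Finset.smul_sum, smul_smul, ← pow_add]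
  rw [← Finset.sum_product', Finset.univ_product_univ]
  refine Finset.sum_involution
    (fun ij _ => (ij.1.succAbove ij.2, ij.2.predAbove ij.1)) ?_ ?_ ?_ ?_
  · rintro ⟨i, j⟩ -
    dsimp only
    rw [ContinuousMap.comp_assoc, ContinuousMap.comp_assoc, facet_comp_facet,
      Fin.neg_one_pow_succAbove_add_predAbove]
    simp
  · rintro ⟨i, j⟩ - - h
    exact Fin.succAbove_ne i j (congrArg Prod.fst h)
  · intro _ _
    exact Finset.mem_univ _
  · rintro ⟨i, j⟩ -
    exact Prod.ext (Fin.succAbove_succAbove_predAbove i j) (Fin.predAbove_predAbove_succAbove i j)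

theorem chainsMap_boundarySucc {X Y : Type} [TopologicalSpace X] [TopologicalSpace Y]
    (g : C(X, Y)) {n : ℕ} (c : Chains X (n + 1)) :
    chainsMap g n (boundarySucc X n c) = boundarySucc Y n (chainsMap g (n + 1) c) := by
  suffices h : (chainsMap g n).comp (boundarySucc X n) =
      (boundarySucc Y n).comp (chainsMap g (n + 1)) from DFunLike.congr_fun h c
  refine Finsupp.addHom_ext' fun s => AddMonoidHom.ext_int ?_
  change chainsMap g n (boundarySucc X n (Finsupp.single s 1)) =
    boundarySucc Y n (chainsMap g (n + 1) (Finsupp.single s 1))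
  simp only [chainsMap_single, boundarySucc_single, map_sum, map_zsmul, ContinuousMap.comp_assoc]

theorem chainsMap_mem_cycles {X Y : Type} [TopologicalSpace X] [TopologicalSpace Y]
    (g : C(X, Y)) {n : ℕ} {c : Chains X n} (hc : c ∈ cycles X n) :
    chainsMap g n c ∈ cycles Y n := by
  cases n with
  | zero => rfl
  | succ n =>
    change boundarySucc Y n (chainsMap g (n + 1) c) = 0
    have hc' : boundarySucc X n c = 0 := hc
    rw [← chainsMap_boundarySucc, hc', map_zero]

/-! ### Winding numbers -/

/-- The facet of `Δ_d` opposite to vertex `i`, as a singular simplex of `∂Δ_d`. -/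
def boundaryFacet {d : ℕ} (i : Fin (d + 1)) : C(stdSimplex ℝ (Fin d), skeleton (Fin (d + 1)) d) where
  toFun x := ⟨facet i x, simplexMap_mem_skeleton _ (mem_skeleton_of_card_le (by simp) x)⟩
  continuous_toFun := (facet i).continuous.subtype_mk _

/-- The fundamental cycle of the sphere `∂Δ_d`: the alternating sum of the facets of `Δ_d`. -/
def fundamentalCycle (d : ℕ) : Chains (skeleton (Fin (d + 1)) d) d :=
  ∑ i : Fin (d + 1), (-1 : ℤ) ^ (i : ℕ) • Finsupp.single (boundaryFacet i) (1 : ℤ)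

theorem fundamentalCycle_mem_cycles (d : ℕ) :
    fundamentalCycle d ∈ cycles (skeleton (Fin (d + 1)) d) d := by
  cases d with
  | zero => rfl
  | succ n =>
    change boundarySucc _ n (fundamentalCycle (n + 1)) = 0
    let ι : C(skeleton (Fin (n + 2)) (n + 1), stdSimplex ℝ (Fin (n + 2))) :=
      ⟨Subtype.val, continuous_subtype_val⟩
    have hinj : Function.Injective (chainsMap ι n) := by
      refine Finsupp.mapDomain_injective fun s t hst => ?_
      ext1 x
      exact Subtype.ext (DFunLike.congr_fun hst x)
    have hι : chainsMap ι (n + 1) (fundamentalCycle (n + 1)) =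
        boundarySucc _ (n + 1) (Finsupp.single (ContinuousMap.id _) 1) := by
      rw [boundarySucc_single, fundamentalCycle, map_sum]
      refine Finset.sum_congr rfl fun i _ => ?_
      rw [map_zsmul, chainsMap_single]
      rfl
    refine hinj ?_
    rw [chainsMap_boundarySucc, hι, boundarySucc_boundarySucc, map_zero]

/-- A map that does not attain `p`, as a map to the complement of `p`. -/
def avoid {X Y : Type} [TopologicalSpace X] [TopologicalSpace Y] (g : C(X, Y)) (p : Y)
    (hp : p ∉ Set.range g) : C(X, ({p}ᶜ : Set Y)) where
  toFun x := ⟨g x, fun h => hp ⟨x, h⟩⟩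
  continuous_toFun := g.continuous.subtype_mk _

/-- The winding number `W(g, p)` of `g : ∂Δ_d → ℝ^d` with respect to a point `p` that `g` does not
attain: the class `[g]` in `H̃_{d-1}(ℝ^d ∖ {p}; ℤ)` (an infinite cyclic group) of the image of the
fundamental cycle of `∂Δ_d`. -/
def windingNumber {d : ℕ} (g : C(skeleton (Fin (d + 1)) d, EuclideanSpace ℝ (Fin d)))
    (p : EuclideanSpace ℝ (Fin d)) (hp : p ∉ Set.range g) :
    ReducedHomology ({p}ᶜ : Set (EuclideanSpace ℝ (Fin d))) d :=
  QuotientAddGroup.mk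
    ⟨chainsMap (avoid g p hp) d (fundamentalCycle d),
      chainsMap_mem_cycles _ (fundamentalCycle_mem_cycles d)⟩

/-! ### The Winding Number Conjecture -/

/-- The restriction of a map `f` on the `(d - 1)`-skeleton of the `N`-simplex to the boundary of
the `d`-face with vertex set `τ`; this face is identified with `Δ_d` through the order of its
vertices. -/
def restrictBoundary {N d : ℕ}
    (f : C(skeleton (Fin (N + 1)) d, EuclideanSpace ℝ (Fin d)))
    (τ : Finset (Fin (N + 1))) (hτ : τ.card = d + 1) :
    C(skeleton (Fin (d + 1)) d, EuclideanSpace ℝ (Fin d)) :=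
  f.comp (skeletonMap (τ.orderEmbOfFin hτ) d)

/-- `p` lies in `f(τ)` if `dim τ ≤ d - 1`; if `dim τ = d`, then `p` lies in `f(∂τ)`, or it does
not and `f` restricted to `∂τ` has nonzero winding number with respect to `p`. -/
def WindsAround {N d : ℕ} (f : C(skeleton (Fin (N + 1)) d, EuclideanSpace ℝ (Fin d)))
    (τ : Finset (Fin (N + 1))) (p : EuclideanSpace ℝ (Fin d)) : Prop :=
  (τ.card ≤ d ∧ ∃ x : skeleton (Fin (N + 1)) d, x.1 ∈ face τ ∧ f x = p) ∨
  (∃ hτ : τ.card = d + 1, p ∈ Set.range (restrictBoundary f τ hτ) ∨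
    ∃ hp : p ∉ Set.range (restrictBoundary f τ hτ),
      windingNumber (restrictBoundary f τ hτ) p hp ≠ 0)

/-- The `q` faces `σ i` form a winding partition for `f` with winding point `p`. -/
def IsWindingPartition {N d q : ℕ} (f : C(skeleton (Fin (N + 1)) d, EuclideanSpace ℝ (Fin d)))
    (σ : Fin q → Finset (Fin (N + 1))) (p : EuclideanSpace ℝ (Fin d)) : Prop :=
  (∀ i, (σ i).Nonempty) ∧ (∀ i j, i ≠ j → Disjoint (σ i) (σ j)) ∧ ∀ i, WindsAround f (σ i) p

/-- The Winding Number Conjecture for given `q` and `d`: every continuous map from the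
`(d - 1)`-skeleton of the simplex of dimension `(d + 1)(q - 1)` to `ℝ^d` has a winding partition
into `q` faces. -/
def WindingNumberConjecture (q d : ℕ) : Prop :=
  ∀ f : C(skeleton (Fin ((d + 1) * (q - 1) + 1)) d, EuclideanSpace ℝ (Fin d)),
    ∃ (σ : Fin q → Finset (Fin ((d + 1) * (q - 1) + 1))) (p : EuclideanSpace ℝ (Fin d)),
      IsWindingPartition f σ p

end

end Winding

namespace Winding

noncomputable section

/-! ### Coordinates of the induced maps between simplices -/

theorem simplexMap_apply_of_injective {V W : Type} [Fintype V] [Fintype W] {j : V → W}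
    (hj : Function.Injective j) (x : stdSimplex ℝ V) (v : V) : simplexMap j x (j v) = x v := by
  classical
  change FunOnFinite.linearMap ℝ ℝ j x (j v) = x v
  rw [FunOnFinite.linearMap_apply_apply]
  simp only [hj.eq_iff]
  rw [Finset.sum_filter, Finset.sum_ite_eq' Finset.univ v, if_pos (Finset.mem_univ v)]

theorem simplexMap_apply_of_notMem_range {V W : Type} [Fintype V] [Fintype W] (j : V → W)
    (x : stdSimplex ℝ V) {w : W} (hw : w ∉ Set.range j) : simplexMap j x w = 0 := by
  classical
  change FunOnFinite.linearMap ℝ ℝ j x w = 0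
  rw [FunOnFinite.linearMap_apply_apply]
  exact Finset.sum_eq_zero fun v hv => (hw ⟨v, (Finset.mem_filter.1 hv).2⟩).elim

theorem simplexMap_comp_apply {V W Z : Type} [Fintype V] [Fintype W] [Fintype Z] (j : V → W)
    (k : W → Z) (x : stdSimplex ℝ V) : simplexMap k (simplexMap j x) = simplexMap (k ∘ j) x :=
  stdSimplex.map_comp_apply j k x

theorem simplexMap_injective {V W : Type} [Fintype V] [Fintype W] {j : V → W}
    (hj : Function.Injective j) : Function.Injective (simplexMap j) := by
  intro x y hxy
  refine stdSimplex.ext (funext fun v => ?_)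
  rw [← simplexMap_apply_of_injective hj x v, ← simplexMap_apply_of_injective hj y v, hxy]

theorem facet_apply_succAbove {n : ℕ} (i : Fin (n + 1)) (x : stdSimplex ℝ (Fin n)) (k : Fin n) :
    facet i x (i.succAbove k) = x k :=
  simplexMap_apply_of_injective Fin.succAbove_right_injective x k

theorem facet_apply_self {n : ℕ} (i : Fin (n + 1)) (x : stdSimplex ℝ (Fin n)) :
    facet i x i = 0 :=
  simplexMap_apply_of_notMem_range _ x (by simp)

/-! ### The cone operator -/

section Cone

variable {E : Type} [NormedAddCommGroup E] [NormedSpace ℝ E]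

theorem normalizedTail_mem {n : ℕ} (x : stdSimplex ℝ (Fin (n + 1))) (hx : x 0 ≠ 1) :
    (fun i : Fin n => x i.succ / (1 - x 0)) ∈ stdSimplex ℝ (Fin n) := by
  have h1 : 0 < 1 - x 0 := sub_pos.2 (lt_of_le_of_ne (stdSimplex.le_one x 0) hx)
  refine ⟨fun i => div_nonneg (stdSimplex.zero_le x _) h1.le, ?_⟩
  have hs := stdSimplex.sum_eq_one x
  rw [Fin.sum_univ_succ] at hs
  rw [← Finset.sum_div, div_eq_one_iff_eq h1.ne']
  linarith

/-- The projection of a simplex from its first vertex to the opposite facet. -/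
def normalizedTail {n : ℕ} (x : stdSimplex ℝ (Fin (n + 1))) (hx : x 0 ≠ 1) :
    stdSimplex ℝ (Fin n) :=
  ⟨_, normalizedTail_mem x hx⟩

theorem continuous_coord {V : Type} [Fintype V] (v : V) :
    Continuous fun x : stdSimplex ℝ V => x v :=
  (continuous_apply v).comp continuous_subtype_val

open Classical in
/-- The underlying function of the cone over a singular simplex. -/
def coneFun (a : E) {n : ℕ} (s : C(stdSimplex ℝ (Fin n), E)) (x : stdSimplex ℝ (Fin (n + 1))) :
    E :=
  a + (1 - x 0) • (if h : x 0 ≠ 1 then s (normalizedTail x h) - a else 0)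

theorem continuous_coneFun (a : E) {n : ℕ} (s : C(stdSimplex ℝ (Fin n), E)) :
    Continuous (coneFun a s) := by
  classical
  refine continuous_iff_continuousAt.2 fun x => ?_
  by_cases hx : x 0 = 1
  · obtain ⟨C, hC⟩ : ∃ C, ∀ y, ‖s y - a‖ ≤ C := by
      obtain ⟨C, hC⟩ := (isCompact_range
        (f := fun y => s y - a) (s.continuous.sub continuous_const)).isBounded.exists_norm_le
      exact ⟨C, fun y => hC _ ⟨y, rfl⟩⟩
    have hzero : coneFun a s x = a + 0 := by simp [coneFun, hx]
    unfold ContinuousAt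
    rw [hzero]
    refine tendsto_const_nhds.add ?_
    refine squeeze_zero_norm (a := fun y => ‖1 - y 0‖ * max C 0) (fun y => ?_) ?_
    · rw [norm_smul]
      gcongr
      split_ifs with h
      · exact (hC _).trans (le_max_left _ _)
      · simp
    · have : Filter.Tendsto (fun y : stdSimplex ℝ (Fin (n + 1)) => ‖1 - y 0‖ * max C 0)
          (nhds x) (nhds (‖1 - x 0‖ * max C 0)) :=
        (((continuous_const.sub (continuous_coord 0)).norm.mul continuous_const).tendsto x)
      simpa [hx] using this
  · have hopen : IsOpen {y : stdSimplex ℝ (Fin (n + 1)) | y 0 ≠ 1} :=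
      isOpen_ne_fun (continuous_coord 0) continuous_const
    refine ContinuousOn.continuousAt ?_ (hopen.mem_nhds hx)
    rw [continuousOn_iff_continuous_domRestrict]
    have htail : Continuous fun y : {y : stdSimplex ℝ (Fin (n + 1)) | y 0 ≠ 1} =>
        normalizedTail y.1 y.2 := by
      refine Continuous.subtype_mk (continuous_pi fun i => ?_) _
      refine Continuous.div₀ ((continuous_coord _).comp continuous_subtype_val)
        (continuous_const.sub ((continuous_coord _).comp continuous_subtype_val)) fun y => ?_
      exact sub_ne_zero.2 (Ne.symm y.2)
    have heq : Set.domRestrict {y : stdSimplex ℝ (Fin (n + 1)) | y 0 ≠ 1} (coneFun a s) =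
        fun y => a + (1 - y.1 0) • (s (normalizedTail y.1 y.2) - a) := by
      funext y
      have hy : y.1 0 ≠ 1 := y.2
      rw [Set.domRestrict_apply, coneFun, dif_pos hy]
    rw [heq]
    exact continuous_const.add
      ((continuous_const.sub ((continuous_coord _).comp continuous_subtype_val)).smul
        ((s.continuous.comp htail).sub continuous_const))

/-- The cone with apex `a` over a singular simplex; the apex is the first vertex. -/
def cone (a : E) {n : ℕ} (s : C(stdSimplex ℝ (Fin n), E)) : C(stdSimplex ℝ (Fin (n + 1)), E) :=
  ⟨coneFun a s, continuous_coneFun a s⟩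

theorem cone_apply_of_eq_one (a : E) {n : ℕ} (s : C(stdSimplex ℝ (Fin n), E))
    {x : stdSimplex ℝ (Fin (n + 1))} (hx : x 0 = 1) : cone a s x = a := by
  change coneFun a s x = a
  simp [coneFun, hx]

theorem cone_apply_of_ne_one (a : E) {n : ℕ} (s : C(stdSimplex ℝ (Fin n), E))
    {x : stdSimplex ℝ (Fin (n + 1))} (hx : x 0 ≠ 1) :
    cone a s x = a + (1 - x 0) • (s (normalizedTail x hx) - a) := by
  change coneFun a s x = _
  simp [coneFun, hx]

theorem cone_comp_facet_zero (a : E) {n : ℕ} (s : C(stdSimplex ℝ (Fin n), E)) :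
    (cone a s).comp (facet 0) = s := by
  ext1 x
  have h0 : facet 0 x 0 = 0 := facet_apply_self 0 x
  have h1 : facet 0 x 0 ≠ 1 := by rw [h0]; exact zero_ne_one
  have ht : normalizedTail (facet 0 x) h1 = x := by
    refine stdSimplex.ext (funext fun i => ?_)
    change facet 0 x i.succ / (1 - facet 0 x 0) = x i
    rw [h0, ← Fin.succAbove_zero_apply, facet_apply_succAbove]
    simp
  rw [ContinuousMap.comp_apply, cone_apply_of_ne_one a s h1, ht, h0]
  simp

theorem cone_comp_facet_succ (a : E) {n : ℕ} (s : C(stdSimplex ℝ (Fin (n + 1)), E))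
    (i : Fin (n + 1)) : (cone a s).comp (facet i.succ) = cone a (s.comp (facet i)) := by
  ext1 x
  have h0 : facet i.succ x 0 = x 0 := by
    have := facet_apply_succAbove i.succ x 0
    rwa [Fin.succ_succAbove_zero] at this
  rw [ContinuousMap.comp_apply]
  by_cases hx : x 0 = 1
  · rw [cone_apply_of_eq_one a s (h0.trans hx), cone_apply_of_eq_one a _ hx]
  · have hx' : facet i.succ x 0 ≠ 1 := by rwa [h0]
    have ht : normalizedTail (facet i.succ x) hx' = facet i (normalizedTail x hx) := by
      refine stdSimplex.ext (funext fun k => ?_)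
      change facet i.succ x k.succ / (1 - facet i.succ x 0) = facet i (normalizedTail x hx) k
      rw [h0]
      rcases Fin.eq_self_or_eq_succAbove i k with rfl | ⟨l, rfl⟩
      · rw [facet_apply_self, facet_apply_self, zero_div]
      · rw [facet_apply_succAbove, ← Fin.succ_succAbove_succ, facet_apply_succAbove]
        rfl
    rw [cone_apply_of_ne_one a s hx', cone_apply_of_ne_one a _ hx, ht, h0]
    rfl

/-- The cone operator on singular chains. -/
def coneChain (a : E) (n : ℕ) : Chains E n →+ Chains E (n + 1) :=
  Finsupp.mapDomain.addMonoidHom (cone a)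

theorem coneChain_single (a : E) {n : ℕ} (s : C(stdSimplex ℝ (Fin n), E)) (m : ℤ) :
    coneChain a n (Finsupp.single s m) = Finsupp.single (cone a s) m := by
  simp [coneChain]

theorem boundarySucc_coneChain (a : E) {n : ℕ} (c : Chains E (n + 1)) :
    boundarySucc E (n + 1) (coneChain a (n + 1) c) = c - coneChain a n (boundarySucc E n c) := by
  suffices h : (boundarySucc E (n + 1)).comp (coneChain a (n + 1)) =
      AddMonoidHom.id _ - (coneChain a n).comp (boundarySucc E n) from DFunLike.congr_fun h c
  refine Finsupp.addHom_ext' fun s => AddMonoidHom.ext_int ?_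
  change boundarySucc E (n + 1) (coneChain a (n + 1) (Finsupp.single s 1)) =
    Finsupp.single s 1 - coneChain a n (boundarySucc E n (Finsupp.single s 1))
  rw [coneChain_single, boundarySucc_single, boundarySucc_single, Fin.sum_univ_succ, map_sum,
    cone_comp_facet_zero, sub_eq_add_neg, ← Finset.sum_neg_distrib]
  congr 1
  · simp
  · refine Finset.sum_congr rfl fun i _ => ?_
    rw [map_zsmul, coneChain_single, cone_comp_facet_succ, Fin.val_succ, pow_succ]
    simp

/-- The singular chains of `E` all of whose simplices lie in `S`. -/
abbrev chainsIn (S : Set E) (n : ℕ) : Submodule ℤ (Chains E n) :=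
  Finsupp.supported ℤ ℤ {s | ∀ x, s x ∈ S}

theorem coneChain_mem_chainsIn {a : E} {S : Set E} (hS : StarConvex ℝ a S) (ha : a ∈ S) {n : ℕ}
    {c : Chains E n} (hc : c ∈ chainsIn S n) : coneChain a n c ∈ chainsIn S (n + 1) := by
  classical
  rw [Finsupp.mem_supported] at hc ⊢
  intro t ht
  obtain ⟨s, hs, rfl⟩ := Finset.mem_image.1 (Finsupp.mapDomain_support ht)
  intro x
  by_cases hx : x 0 = 1
  · rwa [cone_apply_of_eq_one a s hx]
  · rw [cone_apply_of_ne_one a s hx]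
    have := hS (hc hs (normalizedTail x hx)) (stdSimplex.zero_le x 0)
      (sub_nonneg.2 (stdSimplex.le_one x 0)) (by ring)
    convert this using 1
    module

theorem exists_boundary_eq_of_starConvex {a : E} {S : Set E} (hS : StarConvex ℝ a S) (ha : a ∈ S)
    {n : ℕ} {c : Chains E (n + 1)} (hc : c ∈ chainsIn S (n + 1)) (hb : boundarySucc E n c = 0) :
    ∃ b ∈ chainsIn S (n + 2), boundarySucc E (n + 1) b = c :=
  ⟨coneChain a (n + 1) c, coneChain_mem_chainsIn hS ha hc, by
    rw [boundarySucc_coneChain, hb, map_zero, sub_zero]⟩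

end Cone

/-! ### Vanishing of winding numbers -/

section Vanishing

variable {d : ℕ}

theorem chainsMap_fundamentalCycle {E : Type} [TopologicalSpace E]
    (g : C(skeleton (Fin (d + 1)) d, E)) :
    chainsMap g d (fundamentalCycle d) = ∑ i : Fin (d + 1), (-1 : ℤ) ^ (i : ℕ) •
      Finsupp.single (g.comp (boundaryFacet i)) (1 : ℤ) := by
  simp only [fundamentalCycle, map_sum, map_zsmul, chainsMap_single]

theorem boundarySucc_chainsMap_fundamentalCycle {E : Type} [TopologicalSpace E]
    (g : C(skeleton (Fin (d + 2)) (d + 1), E)) :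
    boundarySucc E d (chainsMap g (d + 1) (fundamentalCycle (d + 1))) = 0 :=
  chainsMap_mem_cycles g (fundamentalCycle_mem_cycles (d + 1))

/-- The inclusion of a subspace as a continuous map. -/
def inclusion {X : Type} [TopologicalSpace X] (S : Set X) : C(S, X) :=
  ⟨Subtype.val, continuous_subtype_val⟩

theorem chainsMap_inclusion_injective {X : Type} [TopologicalSpace X] (S : Set X) (n : ℕ) :
    Function.Injective (chainsMap (inclusion S) n) := by
  refine Finsupp.mapDomain_injective fun s t hst => ?_
  ext1 x
  exact Subtype.ext (DFunLike.congr_fun hst x)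

theorem exists_chainsMap_inclusion_eq {E : Type} [NormedAddCommGroup E] [NormedSpace ℝ E]
    {S : Set E} {n : ℕ} {c : Chains E n} (hc : c ∈ chainsIn S n) :
    ∃ c', chainsMap (inclusion S) n c' = c := by
  rw [chainsIn, Finsupp.supported_eq_span_single] at hc
  induction hc using Submodule.span_induction with
  | mem x hx =>
    obtain ⟨s, hs, rfl⟩ := hx
    exact ⟨Finsupp.single ⟨fun x => ⟨s x, hs x⟩, s.continuous.subtype_mk _⟩ 1,
      chainsMap_single _ _ _⟩
  | zero => exact ⟨0, map_zero _⟩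
  | add x y _ _ hx hy =>
    obtain ⟨x', rfl⟩ := hx
    obtain ⟨y', rfl⟩ := hy
    exact ⟨x' + y', map_add _ _ _⟩
  | smul a x _ hx =>
    obtain ⟨x', rfl⟩ := hx
    exact ⟨a • x', map_zsmul _ _ _⟩

theorem chainsMap_mem_chainsIn {X E : Type} [TopologicalSpace X] [NormedAddCommGroup E]
    [NormedSpace ℝ E] {S : Set E} (g : C(X, E)) {n : ℕ} {c : Chains X n}
    (hg : ∀ s ∈ c.support, ∀ x, g (s x) ∈ S) : chainsMap g n c ∈ chainsIn S n := by
  classical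
  rw [Finsupp.mem_supported]
  intro t ht
  obtain ⟨s, hs, rfl⟩ := Finset.mem_image.1 (Finsupp.mapDomain_support ht)
  exact hg s hs

theorem windingNumber_eq_zero_iff (g : C(skeleton (Fin (d + 1)) d, EuclideanSpace ℝ (Fin d)))
    (p : EuclideanSpace ℝ (Fin d)) (hp : p ∉ Set.range g) :
    windingNumber g p hp = 0 ↔ ∃ b ∈ chainsIn ({p}ᶜ : Set (EuclideanSpace ℝ (Fin d))) (d + 1),
      boundarySucc _ d b = chainsMap g d (fundamentalCycle d) := by
  have hval : chainsMap (inclusion {p}ᶜ) d (chainsMap (avoid g p hp) d (fundamentalCycle d)) =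
      chainsMap g d (fundamentalCycle d) := by
    simp only [chainsMap_fundamentalCycle, map_sum, map_zsmul, chainsMap_single]
    rfl
  rw [windingNumber, QuotientAddGroup.eq_zero_iff, AddSubgroup.mem_addSubgroupOf]
  constructor
  · rintro ⟨b, hb⟩
    refine ⟨chainsMap (inclusion {p}ᶜ) (d + 1) b, chainsMap_mem_chainsIn _
      fun s _ x => (s x).2, ?_⟩
    rw [← chainsMap_boundarySucc, ← hval]
    exact congrArg _ hb
  · rintro ⟨b, hb, hbd⟩
    obtain ⟨b', rfl⟩ := exists_chainsMap_inclusion_eq hb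
    refine ⟨b', chainsMap_inclusion_injective _ _ ?_⟩
    rw [← chainsMap_boundarySucc, ← hval] at hbd
    exact hbd

end Vanishing

/-! ### Half-spaces and suspensions -/

/-- A closed half-space whose boundary contains `p`, without the point `p`. -/
def puncturedHalfSpace {E : Type} [AddCommGroup E] [Module ℝ E] (l : E →ₗ[ℝ] ℝ) (p : E) : Set E :=
  {y | y ≠ p ∧ l p ≤ l y}

section HalfSpace

variable {E : Type} [NormedAddCommGroup E] [NormedSpace ℝ E] {l : E →ₗ[ℝ] ℝ} {p v : E}

theorem add_mem_puncturedHalfSpace (hv : 0 < l v) : p + v ∈ puncturedHalfSpace l p := by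
  refine ⟨fun h => ?_, by rw [map_add]; linarith⟩
  rw [add_eq_left] at h
  simp [h] at hv

theorem starConvex_puncturedHalfSpace (hv : 0 < l v) :
    StarConvex ℝ (p + v) (puncturedHalfSpace l p) := by
  rintro y ⟨hyp, hy⟩ a b ha hb hab
  have hl : l (a • (p + v) + b • y) = l p + a * l v + b * (l y - l p) := by
    simp only [map_add, map_smul, smul_eq_mul]
    linear_combination l p * hab
  have h1 : 0 ≤ a * l v := mul_nonneg ha hv.le
  have h2 : 0 ≤ b * (l y - l p) := mul_nonneg hb (sub_nonneg.2 hy)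
  refine ⟨fun h => ?_, by rw [hl]; linarith⟩
  rw [h] at hl
  have ha0 : a = 0 := by
    have : a * l v = 0 := by linarith
    exact (mul_eq_zero.1 this).resolve_right hv.ne'
  obtain rfl : b = 1 := by linarith
  rw [ha0] at h
  exact hyp (by simpa using h)

theorem puncturedHalfSpace_subset (l : E →ₗ[ℝ] ℝ) (p : E) :
    puncturedHalfSpace l p ⊆ ({p}ᶜ : Set E) :=
  fun _ hy => hy.1

theorem exists_boundary_eq_of_puncturedHalfSpace (hv : 0 < l v) {n : ℕ} {c : Chains E (n + 1)}
    (hc : c ∈ chainsIn (puncturedHalfSpace l p) (n + 1)) (hb : boundarySucc E n c = 0) :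
    ∃ b ∈ chainsIn ({p}ᶜ : Set E) (n + 2), boundarySucc E (n + 1) b = c := by
  obtain ⟨b, hb, h⟩ := exists_boundary_eq_of_starConvex (starConvex_puncturedHalfSpace hv)
    (add_mem_puncturedHalfSpace hv) hc hb
  exact ⟨b, Finsupp.supported_mono
    (s := {s : C(stdSimplex ℝ (Fin (n + 2)), E) | ∀ x, s x ∈ puncturedHalfSpace l p})
    (fun _ hs x => puncturedHalfSpace_subset l p (hs x)) hb, h⟩

end HalfSpace

theorem windingNumber_eq_zero_of_halfSpace {d : ℕ}
    (g : C(skeleton (Fin (d + 2)) (d + 1), EuclideanSpace ℝ (Fin (d + 1))))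
    (p : EuclideanSpace ℝ (Fin (d + 1))) (hp : p ∉ Set.range g)
    (l : EuclideanSpace ℝ (Fin (d + 1)) →ₗ[ℝ] ℝ) (hl : ∃ v, 0 < l v) (hg : ∀ x, l p ≤ l (g x)) :
    windingNumber g p hp = 0 := by
  obtain ⟨v, hv⟩ := hl
  rw [windingNumber_eq_zero_iff]
  refine exists_boundary_eq_of_puncturedHalfSpace hv
    (chainsMap_mem_chainsIn g fun s _ x => ⟨fun h => hp ⟨_, h⟩, hg _⟩)
    (boundarySucc_chainsMap_fundamentalCycle g)

/-- The last coordinate as a linear functional. -/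
def lastCoord (d : ℕ) : EuclideanSpace ℝ (Fin (d + 1)) →ₗ[ℝ] ℝ where
  toFun y := y (Fin.last d)
  map_add' _ _ := rfl
  map_smul' _ _ := rfl

@[simp]
theorem lastCoord_apply {d : ℕ} (y : EuclideanSpace ℝ (Fin (d + 1))) :
    lastCoord d y = y (Fin.last d) :=
  rfl

theorem exists_lastCoord_pos (d : ℕ) : ∃ v, 0 < lastCoord d v :=
  ⟨EuclideanSpace.single (Fin.last d) 1, by simp⟩

theorem exists_neg_lastCoord_pos (d : ℕ) : ∃ v, 0 < (-lastCoord d) v :=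
  ⟨EuclideanSpace.single (Fin.last d) (-1), by simp⟩

/-- The point of `ℝ^(d+1)` with given first `d` coordinates and given last coordinate. -/
def appendCoord {d : ℕ} (y : EuclideanSpace ℝ (Fin d)) (t : ℝ) : EuclideanSpace ℝ (Fin (d + 1)) :=
  WithLp.toLp 2 (Fin.snoc (α := fun _ => ℝ) y t)

@[simp]
theorem appendCoord_last {d : ℕ} (y : EuclideanSpace ℝ (Fin d)) (t : ℝ) :
    appendCoord y t (Fin.last d) = t :=
  Fin.snoc_last (α := fun _ => ℝ) t y

@[simp]
theorem appendCoord_castSucc {d : ℕ} (y : EuclideanSpace ℝ (Fin d)) (t : ℝ) (i : Fin d) :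
    appendCoord y t i.castSucc = y i :=
  Fin.snoc_castSucc (α := fun _ => ℝ) t y i

theorem appendCoord_injective {d : ℕ} {y z : EuclideanSpace ℝ (Fin d)} {t u : ℝ}
    (h : appendCoord y t = appendCoord z u) : y = z := by
  ext i
  rw [← appendCoord_castSucc y t i, h, appendCoord_castSucc]

theorem exists_appendCoord_eq {d : ℕ} (p : EuclideanSpace ℝ (Fin (d + 1))) :
    ∃ y, appendCoord y (p (Fin.last d)) = p := by
  refine ⟨WithLp.toLp 2 fun i => p i.castSucc, ?_⟩
  ext i
  induction i using Fin.lastCases with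
  | last => simp
  | cast i => simp

theorem continuous_appendCoord {X : Type} [TopologicalSpace X] {d : ℕ}
    {g : X → EuclideanSpace ℝ (Fin d)} {t : X → ℝ} (hg : Continuous g) (ht : Continuous t) :
    Continuous fun x => appendCoord (g x) (t x) := by
  refine (PiLp.continuous_toLp 2 _).comp (continuous_pi fun i => ?_)
  induction i using Fin.lastCases with
  | last => simpa using ht
  | cast i => simpa using! (PiLp.continuous_apply 2 _ i).comp hg

/-- The inclusion of `ℝ^d` as a hyperplane in `ℝ^(d+1)`. -/
def hyperplane (d : ℕ) : C(EuclideanSpace ℝ (Fin d), EuclideanSpace ℝ (Fin (d + 1))) :=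
  ⟨fun y => appendCoord y 0, continuous_appendCoord continuous_id continuous_const⟩

theorem hyperplane_apply {d : ℕ} (y : EuclideanSpace ℝ (Fin d)) :
    hyperplane d y = appendCoord y 0 :=
  rfl

/-- If a sphere in `ℝ^(d+1)` meets the hyperplane `ℝ^d` along the image of the boundary of its last
facet, that facet lying above the hyperplane and the others below, then its winding number
vanishes if that of its equator does. -/
theorem windingNumber_suspension_eq_zero {d : ℕ}
    (φ : C(skeleton (Fin (d + 2)) (d + 1), EuclideanSpace ℝ (Fin (d + 1))))
    (g : C(skeleton (Fin (d + 1)) d, EuclideanSpace ℝ (Fin d))) (p : EuclideanSpace ℝ (Fin d))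
    (hφ : hyperplane d p ∉ Set.range φ) (hp : p ∉ Set.range g)
    (hup : ∀ x, 0 ≤ φ (boundaryFacet (Fin.last (d + 1)) x) (Fin.last d))
    (hlow : ∀ (i : Fin (d + 1)) x, φ (boundaryFacet i.castSucc x) (Fin.last d) ≤ 0)
    (hg : ∀ x : skeleton (Fin (d + 1)) d,
      φ (boundaryFacet (Fin.last (d + 1)) x.1) = hyperplane d (g x))
    (h0 : windingNumber g p hp = 0) : windingNumber φ (hyperplane d p) hφ = 0 := by
  obtain ⟨b, hb, hbd⟩ := (windingNumber_eq_zero_iff g p hp).1 h0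
  rw [windingNumber_eq_zero_iff]
  set T := chainsMap φ (d + 1) (fundamentalCycle (d + 1)) with hT
  set c := chainsMap (hyperplane d) (d + 1) b with hc
  set u : Chains (EuclideanSpace ℝ (Fin (d + 1))) (d + 1) :=
    Finsupp.single (φ.comp (boundaryFacet (Fin.last (d + 1)))) 1 with hu
  have hTd : boundarySucc _ d T = 0 := boundarySucc_chainsMap_fundamentalCycle φ
  have hcd : boundarySucc _ d c = boundarySucc _ d u := by
    rw [hc, ← chainsMap_boundarySucc, hbd, chainsMap_fundamentalCycle, hu, boundarySucc_single,
      map_sum]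
    refine Finset.sum_congr rfl fun i _ => ?_
    rw [map_zsmul, chainsMap_single]
    congr 2
    ext1 x
    exact (hg (boundaryFacet i x)).symm
  have hcmem : ∀ l : EuclideanSpace ℝ (Fin (d + 1)) →ₗ[ℝ] ℝ, (∀ y, l (hyperplane d y) = 0) →
      c ∈ chainsIn (puncturedHalfSpace l (hyperplane d p)) (d + 1) := fun l hl =>
    chainsMap_mem_chainsIn _ fun s hs x =>
      ⟨fun h => hb hs x (appendCoord_injective h), by rw [hl, hl]⟩
  have hsum : T - (-1 : ℤ) ^ (d + 1) • u = ∑ i : Fin (d + 1), (-1 : ℤ) ^ (i : ℕ) •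
      Finsupp.single (φ.comp (boundaryFacet i.castSucc)) (1 : ℤ) := by
    rw [hT, chainsMap_fundamentalCycle, Fin.sum_univ_castSucc]
    simp [hu]
  obtain ⟨v, hv⟩ := exists_lastCoord_pos d
  obtain ⟨w, hw⟩ := exists_neg_lastCoord_pos d
  obtain ⟨B, hB, hBd⟩ := exists_boundary_eq_of_puncturedHalfSpace (p := hyperplane d p) hv
    (c := u - c) (sub_mem (Finsupp.single_mem_supported ℤ 1 fun x =>
      ⟨fun h => hφ ⟨_, h⟩, by simpa [hyperplane_apply] using hup x⟩)
      (hcmem _ fun y => by simp [hyperplane_apply])) (by rw [map_sub, hcd, sub_self])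
  obtain ⟨B', hB', hBd'⟩ := exists_boundary_eq_of_puncturedHalfSpace (p := hyperplane d p) hw
    (c := (T - (-1 : ℤ) ^ (d + 1) • u) + (-1 : ℤ) ^ (d + 1) • c)
    (add_mem (by
      rw [hsum]
      exact sum_mem fun i _ => Submodule.smul_mem _ _ (Finsupp.single_mem_supported ℤ 1 fun x =>
        ⟨fun h => hφ ⟨_, h⟩, by simpa [hyperplane_apply] using hlow i x⟩))
      (Submodule.smul_mem _ _ (hcmem _ fun y => by simp [hyperplane_apply])))
    (by rw [map_add, map_sub, map_zsmul, map_zsmul, hcd, hTd]; simp)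
  refine ⟨B' + (-1 : ℤ) ^ (d + 1) • B, add_mem hB' (Submodule.smul_mem _ _ hB), ?_⟩
  rw [map_add, map_zsmul, hBd, hBd', smul_sub]
  abel

/-! ### Heights -/

section Height

variable {V : Type} [Fintype V]

/-- The set of vertices with nonzero coordinate. -/
def vertexSupport (y : stdSimplex ℝ V) : Finset V :=
  Finset.univ.filter fun v => y v ≠ 0

theorem mem_vertexSupport {y : stdSimplex ℝ V} {v : V} : v ∈ vertexSupport y ↔ y v ≠ 0 := by
  simp [vertexSupport]

theorem vertexSupport_subset_iff {y : stdSimplex ℝ V} {τ : Finset V} :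
    vertexSupport y ⊆ τ ↔ y ∈ face τ := by
  simp only [Finset.subset_iff, mem_vertexSupport, face, Set.mem_ofPred_eq]
  exact forall_congr' fun v => not_imp_comm

theorem vertexSupport_nonempty (y : stdSimplex ℝ V) : (vertexSupport y).Nonempty := by
  by_contra h
  rw [Finset.not_nonempty_iff_eq_empty] at h
  have hs := stdSimplex.sum_eq_one y
  rw [Finset.sum_eq_zero fun v _ => (vertexSupport_subset_iff.1 h.subset) v (by simp)] at hs
  exact zero_ne_one hs

variable [DecidableEq V]

/-- A height function on the simplex with vertex set `V`: on its `(m - 1)`-skeleton it is positive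
in the interiors of the `(m - 1)`-faces spanned by vertices in `O`, zero on their boundaries, and
negative elsewhere. -/
def height (O : Finset V) (m : ℕ) (y : stdSimplex ℝ V) : ℝ :=
  ∑ τ ∈ O.powersetCard m, ∏ v ∈ τ, y v - ∑ v ∈ Oᶜ, y v

theorem continuous_height (O : Finset V) (m : ℕ) : Continuous (height O m) :=
  (continuous_finsetSum _ fun _ _ => continuous_finsetProd _ fun v _ => continuous_coord v).sub
    (continuous_finsetSum _ fun v _ => continuous_coord v)

theorem height_nonneg {O τ : Finset V} (m : ℕ) {y : stdSimplex ℝ V} (hy : y ∈ face τ)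
    (hτ : τ ⊆ O) : 0 ≤ height O m y := by
  have h0 : ∑ v ∈ Oᶜ, y v = 0 :=
    Finset.sum_eq_zero fun v hv => hy v fun h => Finset.mem_compl.1 hv (hτ h)
  rw [height, h0, sub_zero]
  exact Finset.sum_nonneg fun _ _ => Finset.prod_nonneg fun v _ => stdSimplex.zero_le y v

theorem sum_prod_eq_zero {O σ : Finset V} {m : ℕ} {y : stdSimplex ℝ V} (hy : y ∈ face σ)
    (hσ : (σ ∩ O).card < m) : ∑ τ ∈ O.powersetCard m, ∏ v ∈ τ, y v = 0 := by
  refine Finset.sum_eq_zero fun τ hτ => ?_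
  obtain ⟨hτO, hτm⟩ := Finset.mem_powersetCard.1 hτ
  obtain ⟨v, hv, hvσ⟩ := Finset.exists_mem_notMem_of_card_lt_card (hσ.trans_eq hτm.symm)
  exact Finset.prod_eq_zero hv (hy v fun h => hvσ (Finset.mem_inter.2 ⟨h, hτO hv⟩))

theorem height_nonpos {O σ : Finset V} {m : ℕ} {y : stdSimplex ℝ V} (hy : y ∈ face σ)
    (hσ : (σ ∩ O).card < m) : height O m y ≤ 0 := by
  rw [height, sum_prod_eq_zero hy hσ, zero_sub, neg_nonpos]
  exact Finset.sum_nonneg fun v _ => stdSimplex.zero_le y v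

theorem vertexSupport_of_height_eq_zero {O : Finset V} {m : ℕ} {y : stdSimplex ℝ V}
    (hy : y ∈ skeleton V m) (h0 : height O m y = 0) :
    vertexSupport y ⊆ O ∧ (vertexSupport y).card < m := by
  obtain ⟨ρ, hρ, hyρ⟩ := hy
  have hcard : (vertexSupport y).card ≤ m :=
    (Finset.card_le_card (vertexSupport_subset_iff.2 hyρ)).trans hρ
  have hface : y ∈ face (vertexSupport y) := vertexSupport_subset_iff.1 subset_rfl
  have hO : vertexSupport y ⊆ O := by
    intro w hw
    by_contra hwO
    have hlt : (vertexSupport y ∩ O).card < m := by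
      refine (Finset.card_lt_card ?_).trans_le hcard
      exact Finset.ssubset_iff_subset_ne.2 ⟨Finset.inter_subset_left, fun h =>
        hwO (Finset.inter_eq_left.1 h hw)⟩
    rw [height, sum_prod_eq_zero hface hlt, zero_sub, neg_eq_zero,
      Finset.sum_eq_zero_iff_of_nonneg fun v _ => stdSimplex.zero_le y v] at h0
    exact mem_vertexSupport.1 hw (h0 w (Finset.mem_compl.2 hwO))
  refine ⟨hO, lt_of_le_of_ne hcard fun hm => ?_⟩
  have hz : ∑ v ∈ Oᶜ, y v = 0 :=
    Finset.sum_eq_zero fun v hv => hface v fun h => Finset.mem_compl.1 hv (hO h)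
  rw [height, hz, sub_zero, Finset.sum_eq_zero_iff_of_nonneg fun _ _ =>
    Finset.prod_nonneg fun v _ => stdSimplex.zero_le y v] at h0
  have := h0 _ (Finset.mem_powersetCard.2 ⟨hO, hm⟩)
  obtain ⟨v, hv, hv0⟩ := Finset.prod_eq_zero_iff.1 this
  exact mem_vertexSupport.1 hv hv0

end Height

theorem isClosed_skeleton (V : Type) [Fintype V] (m : ℕ) : IsClosed (skeleton V m) := by
  have : skeleton V m = ⋃ τ ∈ {τ : Finset V | τ.card ≤ m}, face τ := by
    ext x
    simp [skeleton]
  rw [this]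
  refine (Set.toFinite _).isClosed_biUnion fun τ _ => ?_
  simp only [face, Set.ofPred_forall]
  exact isClosed_iInter fun v => isClosed_iInter fun _ =>
    isClosed_eq (continuous_coord v) continuous_const

/-! ### Raising a map by one dimension -/

theorem simplexMap_mem_face_of_forall_mem {V W : Type} [Fintype V] [Fintype W] {j : V → W}
    {σ : Finset W} (hj : ∀ v, j v ∈ σ) (x : stdSimplex ℝ V) : simplexMap j x ∈ face σ := by
  intro w hw
  refine simplexMap_apply_of_notMem_range j x ?_
  rintro ⟨v, rfl⟩
  exact hw (hj v)

theorem exists_simplexMap_eq {V W : Type} [Fintype V] [Fintype W] {j : V → W}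
    (hj : Function.Injective j) {y : stdSimplex ℝ W} (hy : ∀ w, y w ≠ 0 → w ∈ Set.range j) :
    ∃ x, simplexMap j x = y := by
  have hy' : ∀ w, w ∉ Set.range j → y w = 0 := fun w hw => not_not.1 fun h => hw (hy w h)
  have hsum : ∑ v, y (j v) = 1 := by
    rw [Fintype.sum_of_injective j hj (fun v => y (j v)) y hy' fun _ => rfl,
      stdSimplex.sum_eq_one]
  let x : stdSimplex ℝ V := ⟨fun v => y (j v), fun v => stdSimplex.zero_le y _, hsum⟩
  refine ⟨x, stdSimplex.ext (funext fun w => ?_)⟩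
  by_cases hw : w ∈ Set.range j
  · obtain ⟨v, rfl⟩ := hw
    exact simplexMap_apply_of_injective hj x v
  · rw [hy' w hw]
    exact simplexMap_apply_of_notMem_range j x hw

theorem isClosedEmbedding_simplexMap {V W : Type} [Fintype V] [Fintype W] {j : V → W}
    (hj : Function.Injective j) (m : ℕ) :
    Topology.IsClosedEmbedding fun x : skeleton V m => simplexMap j x.1 := by
  have : CompactSpace (skeleton V m) := isCompact_iff_compactSpace.1 (isClosed_skeleton V m).isCompact
  exact ((simplexMap j).continuous.comp continuous_subtype_val).isClosedEmbedding
    ((simplexMap_injective hj).comp Subtype.val_injective)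

/-- If a linear functional is nonnegative on the image of a face, then it is nonnegative on the
points around which the face winds. -/
theorem WindsAround.nonneg {M d : ℕ}
    {F : C(skeleton (Fin (M + 1)) (d + 1), EuclideanSpace ℝ (Fin (d + 1)))}
    {σ : Finset (Fin (M + 1))} {p : EuclideanSpace ℝ (Fin (d + 1))} (h : WindsAround F σ p)
    (l : EuclideanSpace ℝ (Fin (d + 1)) →ₗ[ℝ] ℝ) (hl : ∃ v, 0 < l v)
    (hF : ∀ y : skeleton (Fin (M + 1)) (d + 1), y.1 ∈ face σ → 0 ≤ l (F y)) : 0 ≤ l p := by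
  rcases h with ⟨-, y, hy, rfl⟩ | ⟨hσ, ⟨x, rfl⟩ | ⟨hp, hw⟩⟩
  · exact hF y hy
  · exact hF _ (simplexMap_mem_face_of_forall_mem (Finset.orderEmbOfFin_mem σ hσ) x.1)
  · by_contra hlp
    refine hw (windingNumber_eq_zero_of_halfSpace _ p hp l hl fun x => ?_)
    exact (not_le.1 hlp).le.trans
      (hF _ (simplexMap_mem_face_of_forall_mem (Finset.orderEmbOfFin_mem σ hσ) x.1))

/-- The first `N + 1` vertices of the `M`-simplex. -/
def initialVertices (N M : ℕ) : Finset (Fin (M + 1)) :=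
  Finset.univ.filter fun v => (v : ℕ) ≤ N

theorem mem_initialVertices {N M : ℕ} {v : Fin (M + 1)} : v ∈ initialVertices N M ↔ (v : ℕ) ≤ N := by
  simp [initialVertices]

theorem initialVertices_eq_map {N M : ℕ} (h : N + 1 ≤ M + 1) :
    initialVertices N M = Finset.univ.map (Fin.castLEEmb h) := by
  ext v
  simp only [mem_initialVertices, Finset.mem_map, Finset.mem_univ, true_and]
  exact ⟨fun hv => ⟨⟨v, by omega⟩, rfl⟩, by rintro ⟨w, rfl⟩; exact Nat.lt_succ_iff.1 w.2⟩

theorem card_initialVertices {N M : ℕ} (h : N + 1 ≤ M + 1) :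
    (initialVertices N M).card = N + 1 := by
  simp [initialVertices_eq_map h]

theorem castLE_mem_initialVertices {N M : ℕ} (h : N + 1 ≤ M + 1) (v : Fin (N + 1)) :
    Fin.castLE h v ∈ initialVertices N M :=
  mem_initialVertices.2 (Nat.lt_succ_iff.1 v.2)

section Raise

variable {N M d : ℕ}

/-- The map on the `d`-skeleton of the `M`-simplex with first coordinates `G`, and with the height
with respect to the first `N + 1` vertices as the last coordinate. -/
def raise (N : ℕ) (G : C(stdSimplex ℝ (Fin (M + 1)), EuclideanSpace ℝ (Fin d))) :
    C(skeleton (Fin (M + 1)) (d + 1), EuclideanSpace ℝ (Fin (d + 1))) :=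
  ⟨fun y => appendCoord (G y.1) (height (initialVertices N M) (d + 1) y.1),
    continuous_appendCoord (G.continuous.comp continuous_subtype_val)
      ((continuous_height _ _).comp continuous_subtype_val)⟩

theorem raise_apply (G : C(stdSimplex ℝ (Fin (M + 1)), EuclideanSpace ℝ (Fin d)))
    (y : skeleton (Fin (M + 1)) (d + 1)) :
    raise N G y = appendCoord (G y.1) (height (initialVertices N M) (d + 1) y.1) :=
  rfl

variable {f : C(skeleton (Fin (N + 1)) d, EuclideanSpace ℝ (Fin d))}
  {G : C(stdSimplex ℝ (Fin (M + 1)), EuclideanSpace ℝ (Fin d))} {h : N + 1 ≤ M + 1}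
  {p : EuclideanSpace ℝ (Fin d)} {σ : Finset (Fin (M + 1))}

theorem raise_eq_hyperplane (hG : ∀ x, G (simplexMap (Fin.castLE h) x.1) = f x)
    {y : skeleton (Fin (M + 1)) (d + 1)} {x : skeleton (Fin (N + 1)) d}
    (hxy : y.1 = simplexMap (Fin.castLE h) x.1) : raise N G y = hyperplane d (f x) := by
  have hheight : height (initialVertices N M) (d + 1) y.1 = 0 := by
    obtain ⟨τ, hτ, hx⟩ := x.2
    have hy : y.1 ∈ face (τ.image (Fin.castLE h)) := hxy ▸ simplexMap_mem_face _ hx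
    refine le_antisymm (height_nonpos hy ?_) (height_nonneg _ hy fun v hv => ?_)
    · exact Nat.lt_succ_of_le
        ((Finset.card_le_card Finset.inter_subset_left).trans (Finset.card_image_le.trans hτ))
    · obtain ⟨w, -, rfl⟩ := Finset.mem_image.1 hv
      exact castLE_mem_initialVertices h w
  rw [raise_apply, hheight, hxy, hG, hyperplane_apply]

theorem exists_windsAround_of_raise_eq (hG : ∀ x, G (simplexMap (Fin.castLE h) x.1) = f x)
    {y : skeleton (Fin (M + 1)) (d + 1)} (hyσ : y.1 ∈ face σ)
    (hy : raise N G y = hyperplane d p) :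
    ∃ τ : Finset (Fin (N + 1)), τ.Nonempty ∧ τ.map (Fin.castLEEmb h) ⊆ σ ∧ WindsAround f τ p := by
  have h0 : height (initialVertices N M) (d + 1) y.1 = 0 := by
    have := congrArg (fun z => z (Fin.last d)) hy
    simpa [raise_apply, hyperplane_apply] using this
  obtain ⟨hO, hcard⟩ := vertexSupport_of_height_eq_zero y.2 h0
  obtain ⟨x, hx⟩ : ∃ x, simplexMap (Fin.castLE h) x = y.1 := by
    refine exists_simplexMap_eq (Fin.castLE_injective h) fun w hw => ?_
    have := hO (mem_vertexSupport.2 hw)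
    rw [initialVertices_eq_map h] at this
    obtain ⟨v, -, hv⟩ := Finset.mem_map.1 this
    exact ⟨v, hv⟩
  have hsub : (vertexSupport x).map (Fin.castLEEmb h) ⊆ vertexSupport y.1 := by
    intro w hw
    obtain ⟨v, hv, rfl⟩ := Finset.mem_map.1 hw
    rw [mem_vertexSupport] at hv ⊢
    rw [← hx]
    exact (simplexMap_apply_of_injective (Fin.castLE_injective h) x v).trans_ne hv
  have hxcard : (vertexSupport x).card ≤ d := by
    have := Finset.card_le_card hsub
    rw [Finset.card_map] at this
    omega
  have hface : x ∈ face (vertexSupport x) := vertexSupport_subset_iff.1 subset_rfl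
  refine ⟨vertexSupport x, vertexSupport_nonempty x,
    hsub.trans (vertexSupport_subset_iff.2 hyσ), Or.inl ⟨hxcard, ⟨x, _, hxcard, hface⟩, hface, ?_⟩⟩
  rw [raise_eq_hyperplane hG (x := ⟨x, _, hxcard, hface⟩) hx.symm] at hy
  exact appendCoord_injective hy

/-- The increasing enumeration of a set of vertices with exactly one non-initial vertex. -/
theorem orderEmbOfFin_castSucc_of_card (hσ : σ.card = d + 2) {τ : Finset (Fin (N + 1))}
    (hτ : τ.card = d + 1) (hτσ : τ.map (Fin.castLEEmb h) ⊆ σ) {w : Fin (M + 1)} (hw : w ∈ σ)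
    (hwO : w ∉ initialVertices N M) (i : Fin (d + 1)) :
    σ.orderEmbOfFin hσ i.castSucc = Fin.castLE h (τ.orderEmbOfFin hτ i) := by
  let k : Fin (d + 2) → Fin (M + 1) :=
    Fin.snoc (α := fun _ => Fin (M + 1)) (fun i => Fin.castLE h (τ.orderEmbOfFin hτ i)) w
  have hkc : ∀ i : Fin (d + 1), k i.castSucc = Fin.castLE h (τ.orderEmbOfFin hτ i) := fun i =>
    Fin.snoc_castSucc (α := fun _ => Fin (M + 1)) _ _ i
  have hkl : k (Fin.last (d + 1)) = w := Fin.snoc_last (α := fun _ => Fin (M + 1)) _ _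
  have hmem : ∀ i, k i ∈ σ := by
    intro i
    induction i using Fin.lastCases with
    | last => rwa [hkl]
    | cast i =>
      rw [hkc]
      exact hτσ (Finset.mem_map.2 ⟨_, Finset.orderEmbOfFin_mem τ hτ i, rfl⟩)
  have hmono : StrictMono k := by
    rw [Fin.strictMono_iff_lt_succ]
    intro i
    induction i using Fin.lastCases with
    | last =>
      rw [Fin.succ_last, hkl, hkc, Fin.lt_def]
      rw [mem_initialVertices] at hwO
      have := (τ.orderEmbOfFin hτ (Fin.last d)).2
      rw [Fin.val_castLE]
      omega
    | cast i =>
      rw [← Fin.castSucc_succ, hkc, hkc]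
      exact (τ.orderEmbOfFin hτ).strictMono Fin.castSucc_lt_succ
  rw [← Finset.orderEmbOfFin_unique hσ hmem hmono, hkc]

theorem exists_windsAround_of_windingNumber_ne_zero
    (hG : ∀ x, G (simplexMap (Fin.castLE h) x.1) = f x) (hσ : σ.card = d + 2)
    (hp : hyperplane d p ∉ Set.range (restrictBoundary (raise N G) σ hσ))
    (hw : windingNumber (restrictBoundary (raise N G) σ hσ) (hyperplane d p) hp ≠ 0) :
    ∃ τ : Finset (Fin (N + 1)), τ.Nonempty ∧ τ.map (Fin.castLEEmb h) ⊆ σ ∧ WindsAround f τ p := by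
  set O := initialVertices N M with hO
  have hmem : ∀ x : skeleton (Fin (d + 2)) (d + 1),
      (skeletonMap (σ.orderEmbOfFin hσ) (d + 1) x).1 ∈ face σ := fun x =>
    simplexMap_mem_face_of_forall_mem (Finset.orderEmbOfFin_mem σ hσ) x.1
  have hnew : ¬ σ ⊆ O := fun hsub => hw <| by
    refine windingNumber_eq_zero_of_halfSpace _ _ hp _ (exists_lastCoord_pos d) fun x => ?_
    simpa [restrictBoundary, raise_apply, hyperplane_apply] using height_nonneg _ (hmem x) hsub
  have hold : d < (σ ∩ O).card := by
    by_contra hle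
    refine hw (windingNumber_eq_zero_of_halfSpace _ _ hp _ (exists_neg_lastCoord_pos d) fun x => ?_)
    simpa [restrictBoundary, raise_apply, hyperplane_apply] using
      height_nonpos (hmem x) (Nat.lt_succ_of_le (not_lt.1 hle))
  obtain ⟨w, hwσ, hwO⟩ := Finset.not_subset.1 hnew
  have hcard : (σ ∩ O).card = d + 1 := by
    have : (σ ∩ O).card < σ.card := Finset.card_lt_card <|
      Finset.ssubset_iff_subset_ne.2 ⟨Finset.inter_subset_left, fun h =>
        hnew (Finset.inter_eq_left.1 h)⟩
    omega
  let τ : Finset (Fin (N + 1)) := Finset.univ.filter fun v => Fin.castLE h v ∈ σ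
  have hτσ : τ.map (Fin.castLEEmb h) = σ ∩ O := by
    ext v
    simp only [τ, hO, initialVertices_eq_map h, Finset.mem_map, Finset.mem_filter, Finset.mem_univ,
      true_and, Finset.mem_inter]
    constructor
    · rintro ⟨u, hu, rfl⟩
      exact ⟨hu, u, rfl⟩
    · rintro ⟨hv, u, rfl⟩
      exact ⟨u, hv, rfl⟩
  have hτ : τ.card = d + 1 := by rw [← hcard, ← hτσ, Finset.card_map]
  have hsub : τ.map (Fin.castLEEmb h) ⊆ σ := hτσ.trans_subset Finset.inter_subset_left
  have hemb := orderEmbOfFin_castSucc_of_card (h := h) hσ hτ hsub hwσ hwO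
  have hlast : ∀ x : stdSimplex ℝ (Fin (d + 1)),
      simplexMap (σ.orderEmbOfFin hσ) (facet (Fin.last (d + 1)) x) =
        simplexMap (Fin.castLE h) (simplexMap (τ.orderEmbOfFin hτ) x) := by
    intro x
    rw [simplexMap_comp_apply, simplexMap_comp_apply]
    congr 1
    congr 1
    funext i
    simpa using hemb i
  have hg : ∀ x : skeleton (Fin (d + 1)) d, restrictBoundary (raise N G) σ hσ
      (boundaryFacet (Fin.last (d + 1)) x.1) = hyperplane d (restrictBoundary f τ hτ x) := fun x =>
    raise_eq_hyperplane hG (hlast x.1)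
  refine ⟨τ, Finset.card_pos.1 (by omega), hsub, Or.inr ⟨hτ, Or.inr ⟨?_, fun h0 => hw ?_⟩⟩⟩
  · rintro ⟨x, rfl⟩
    exact hp ⟨_, hg x⟩
  · refine windingNumber_suspension_eq_zero _ _ p hp _ (fun x => ?_) (fun i x => ?_) hg h0
    · refine le_of_le_of_eq ?_ (appendCoord_last _ _).symm
      refine height_nonneg (τ := O) _ ?_ subset_rfl
      change simplexMap (σ.orderEmbOfFin hσ) (facet (Fin.last (d + 1)) x) ∈ face O
      rw [hlast]
      exact simplexMap_mem_face_of_forall_mem (castLE_mem_initialVertices h) _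
    · refine (appendCoord_last _ _).trans_le ?_
      refine height_nonpos (σ := σ.erase (σ.orderEmbOfFin hσ i.castSucc)) ?_ ?_
      · change simplexMap (σ.orderEmbOfFin hσ) (facet i.castSucc x) ∈ _
        rw [simplexMap_comp_apply]
        refine simplexMap_mem_face_of_forall_mem (fun v => Finset.mem_erase.2
          ⟨fun he => ?_, Finset.orderEmbOfFin_mem σ hσ _⟩) x
        exact Fin.succAbove_ne _ _ ((σ.orderEmbOfFin hσ).injective he)
      · rw [Finset.erase_inter]
        refine (Finset.card_erase_lt_of_mem (Finset.mem_inter.2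
          ⟨Finset.orderEmbOfFin_mem σ hσ _, ?_⟩)).trans_eq hcard
        rw [hemb]
        exact castLE_mem_initialVertices h _

theorem exists_windsAround_of_windsAround_raise
    (hG : ∀ x, G (simplexMap (Fin.castLE h) x.1) = f x)
    (hσ : WindsAround (raise N G) σ (hyperplane d p)) :
    ∃ τ : Finset (Fin (N + 1)), τ.Nonempty ∧ τ.map (Fin.castLEEmb h) ⊆ σ ∧ WindsAround f τ p := by
  rcases hσ with ⟨-, y, hyσ, hy⟩ | ⟨hσ, ⟨x, hx⟩ | ⟨hp, hw⟩⟩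
  · exact exists_windsAround_of_raise_eq hG hyσ hy
  · exact exists_windsAround_of_raise_eq hG
      (simplexMap_mem_face_of_forall_mem (Finset.orderEmbOfFin_mem σ hσ) x.1) hx
  · exact exists_windsAround_of_windingNumber_ne_zero hG hσ hp hw

end Raise

theorem sum_card_inter_le {ι V : Type} [Fintype ι] [DecidableEq V] {σ : ι → Finset V}
    (hσ : ∀ i j, i ≠ j → Disjoint (σ i) (σ j)) (A : Finset V) : ∑ i, (σ i ∩ A).card ≤ A.card := by
  rw [← Finset.card_biUnion fun i _ j _ hij =>
    (hσ i j hij).mono Finset.inter_subset_left Finset.inter_subset_left]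
  exact Finset.card_le_card (Finset.biUnion_subset.2 fun i _ => Finset.inter_subset_right)

theorem exists_card_inter_lt {ι V : Type} [Fintype ι] [DecidableEq V] {σ : ι → Finset V}
    (hσ : ∀ i j, i ≠ j → Disjoint (σ i) (σ j)) (A : Finset V) {m : ℕ}
    (hA : A.card < Fintype.card ι * m) : ∃ i, (σ i ∩ A).card < m := by
  by_contra! hm
  have h1 := Finset.card_nsmul_le_sum Finset.univ (fun i => (σ i ∩ A).card) m fun i _ => hm i
  have h2 := sum_card_inter_le hσ A
  rw [smul_eq_mul, Finset.card_univ] at h1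
  omega

end

end Winding

open Winding

theorem mainTheorem3 (q d : ℕ) (hq : 2 ≤ q) (hd : 1 ≤ d)
    (h : Winding.WindingNumberConjecture q (d + 1)) : Winding.WindingNumberConjecture q d := by
  intro f
  have hle : (d + 1) * (q - 1) + 1 ≤ (d + 1 + 1) * (q - 1) + 1 := by gcongr; omega
  obtain ⟨G, hG⟩ := f.exists_extension'
    (isClosedEmbedding_simplexMap (Fin.castLE_injective hle) d)
  replace hG : ∀ x, G (simplexMap (Fin.castLE hle) x.1) = f x := fun x => congrFun hG x
  obtain ⟨σ, p', -, hdisj, hwind⟩ := h (raise ((d + 1) * (q - 1)) G)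
  set O := initialVertices ((d + 1) * (q - 1)) ((d + 1 + 1) * (q - 1)) with hO
  have hOcard : O.card = (d + 1) * (q - 1) + 1 := card_initialVertices hle
  obtain ⟨r, rfl⟩ : ∃ r, q = r + 1 := ⟨q - 1, by omega⟩
  have hpos : 0 ≤ p' (Fin.last d) := by
    obtain ⟨i, hi⟩ := exists_card_inter_lt hdisj Oᶜ (m := 1) (by
      rw [Finset.card_compl, hOcard, Fintype.card_fin, Fintype.card_fin, Nat.add_sub_cancel,
        add_mul (d + 1) 1 r]
      omega)
    rw [Nat.lt_one_iff, Finset.card_eq_zero, ← Finset.disjoint_iff_inter_eq_empty,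
      disjoint_compl_right_iff] at hi
    refine (hwind i).nonneg (lastCoord d) (exists_lastCoord_pos d) fun y hy => ?_
    rw [lastCoord_apply, raise_apply, appendCoord_last]
    exact height_nonneg _ hy hi
  have hneg : p' (Fin.last d) ≤ 0 := by
    obtain ⟨i, hi⟩ := exists_card_inter_lt hdisj O (m := d + 1) (by
      rw [hOcard, Fintype.card_fin, Nat.add_sub_cancel, add_mul r 1, mul_comm r]
      omega)
    have := (hwind i).nonneg (-lastCoord d) (exists_neg_lastCoord_pos d) fun y hy => by
      rw [LinearMap.neg_apply, lastCoord_apply, raise_apply, appendCoord_last, neg_nonneg]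
      exact height_nonpos hy hi
    simpa using this
  obtain ⟨p, hp⟩ := exists_appendCoord_eq p'
  rw [le_antisymm hneg hpos, ← hyperplane_apply] at hp
  subst hp
  choose τ hτ hτσ hτw using fun i => exists_windsAround_of_windsAround_raise hG (hwind i)
  refine ⟨τ, p, hτ, fun i j hij => ?_, hτw⟩
  rw [← Finset.disjoint_map (Fin.castLEEmb hle)]
  exact (hdisj i j hij).mono (hτσ i) (hτσ j)
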